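/- **Setting.** Let $n\ge 1$ and let $\kappa_1\ge\cdots\ge\kappa_n\ge 0$ be integers with $m=\kappa_1+\cdots+\kappa_n$. The partition polytope $\mathrm{PP}(\kappa_1,\ldots,\kappa_n)\subset\mathbb R^{nm}$ is the set of all $(y_{ij})_{1\le i\le n,\,1\le j\le m}$ with $\sum_{j=1}^m y_{ij}=\kappa_i$ for all $i$, $\sum_{i=1}^n y_{ij}=1$ for all $j$, and $y_{ij}\ge 0$ for all $i,j$. Its diameter is the maximum graph distance between two vertices in its edge graph (the nodes are the vertices of the polytope, and two of them are adjacent if the segment between them is an edge of the polytope). The support $\mathrm{supp}(\pi)$ of a permutation $\pi\in S_m$ is the set of points that $\pi$ moves. Given a function $p:[m]\to[n]$, a permutation $\pi\in S_m$ is $p$-balanced if $p$ is injective on $\mathrm{supp}(\pi)$; a $p$-cycle is a $p$-balanced permutation that is a cycle, where the identity counts as a (trivial) cycle. **Theorem.** 1. If $\kappa_1\ge\cdots\ge\kappa_n\ge 0$ are integers with $\kappa_1=2$, then $\mathrm{PP}(\kappa_1,\ldots,\kappa_n)$ has diameter at most $3$. 2. This is best possible: $\mathrm{PP}(2,2,2,2)$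 has diameter exactly $3$. 3. For all integers $m,n\ge 0$, every function $p:[m]\to[n]$ and all $p$-balanced permutations $\pi_1,\pi_2\in S_m$ with disjoint supports, there are $p$-cycles $\sigma_1,\sigma_2,\sigma_3\in S_m$ such that $\mathrm{supp}(\sigma_3\sigma_2\sigma_1)=\mathrm{supp}(\pi_2\pi_1)$ and $p\sigma_3\sigma_2\sigma_1=p\pi_2\pi_1$ (products are compositions of maps, the rightmost applied first). -/

import Mathlib

/-- The partition polytope `PP(κ₁, …, κₙ)` in `ℝ^{nm}`, for `m` items and `n` clusters: the matrices
`y` with row sums `κ i`, column sums `1` and nonnegative entries. -/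
def partitionPolytope {n : ℕ} (m : ℕ) (κ : Fin n → ℕ) : Set (Fin n → Fin m → ℝ) :=
  {y | (∀ i, ∑ j, y i j = (κ i : ℝ)) ∧ (∀ j, ∑ i, y i j = 1) ∧ ∀ i j, 0 ≤ y i j}

/-- The graph (1-skeleton) of a polytope `P`: its nodes are the vertices (extreme points) of `P`, and
two distinct vertices are adjacent iff the segment between them is a face of `P`, that is, the set
of maximizers over `P` of some linear functional. -/
def polytopeGraph {E : Type*} [AddCommGroup E] [Module ℝ E] [TopologicalSpace E] (P : Set E) :
    SimpleGraph (P.extremePoints ℝ) where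
  Adj u v := u ≠ v ∧ IsExposed ℝ P (segment ℝ (u : E) (v : E))
  symm := ⟨fun u v h => ⟨h.1.symm, segment_symm ℝ (u : E) (v : E) ▸ h.2⟩⟩
  loopless := ⟨fun _ h => h.1 rfl⟩

/-- `π ∈ S_m` is `p`-balanced if `p` is injective on the support of `π`. -/
def IsPBalanced {m n : ℕ} (p : Fin m → Fin n) (π : Equiv.Perm (Fin m)) : Prop :=
  Set.InjOn p (π.support : Set (Fin m))

/-- A `p`-cycle is a `p`-balanced cycle, where the identity counts as a (trivial) cycle. -/
def IsPCycle {m n : ℕ} (p : Fin m → Fin n) (σ : Equiv.Perm (Fin m)) : Prop :=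
  (σ = 1 ∨ σ.IsCycle) ∧ IsPBalanced p σ

/-! Vertices of the polytope are assignments of items to clusters, and exchanging items along a
nontrivial `p`-cycle traverses an edge, so the upper bound becomes a question about factoring
permutations. When clusters hold at most two items, the items form a digraph on the clusters with an
edge `f j → g j` for each item `j`. Padding it with loops to a 2-regular digraph and extracting a
one-factor writes the change from `f` to `g` as two disjoint balanced permutations
(`exists_isPBalanced_mul`).

Each balanced permutation is a product of two `p`-cycles, which would give four steps;
`exists_three_isPCycle` saves one. Hall's theorem picks one point on every cycle of `π₁` and `π₂`,
with distinct `p`-values. Cycles through the chosen points fuse `π₁` and `π₂⁻¹` into single cycles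
`c₁` and `c₂`, so `π₂ π₁` is `c₂⁻¹`, times two disjoint cycles, times `c₁`. A transposition merges
the two middle cycles. The points are chosen so that, carried across `c₂⁻¹`, it swaps two points of
equal `p`-value and is invisible to `p`.

For sharpness, exchange the contents of two pairs of clusters. All eight items move and an edge
moves at most four, so two edges would use disjoint 4-cycles; but the first would have to be an
involution. -/

/-! ### Joining disjoint cycles -/

theorem List.formPerm_append_cons {α : Type*} [DecidableEq α] (l₁ : List α) (y : α) (l₂ : List α) :
    (l₁ ++ y :: l₂).formPerm = (l₁ ++ [y]).formPerm * (y :: l₂).formPerm := by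
  induction l₁ with
  | nil => simp
  | cons x l ih =>
    cases l with
    | nil => simp
    | cons z l =>
      simp only [List.cons_append, List.formPerm_cons_cons, mul_assoc] at ih ⊢
      rw [ih]

/-- The swap appends `y` to the first cycle, up to rotation; two cycles meeting only at `y` then
concatenate. -/
theorem List.swap_mul_formPerm_mul_formPerm {α : Type*} [DecidableEq α] {x y : α} {l₁ l₂ : List α}
    (h : (y :: x :: l₁).Nodup) :
    Equiv.swap x y * (x :: l₁).formPerm * (y :: l₂).formPerm = (x :: l₁ ++ y :: l₂).formPerm := by
  rw [List.formPerm_append_cons, Equiv.swap_comm, ← List.formPerm_cons_cons,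
    ← List.formPerm_rotate_one _ h]
  simp

namespace Equiv.Perm

variable {α : Type*} [DecidableEq α] [Fintype α]

theorem IsCycle.exists_formPerm_eq {c : Perm α} (hc : c.IsCycle) {z : α} (hz : z ∈ c.support) :
    ∃ l : List α, (z :: l).Nodup ∧ (z :: l).formPerm = c ∧ (z :: l).toFinset = c.support := by
  have hne : c.toList z ≠ [] := by simpa [toList_eq_nil_iff] using hz
  have hnd := nodup_toList c z
  have hf := formPerm_toList c z
  rw [hc.cycleOf_eq (mem_support.1 hz)] at hf
  have h0 := toList_getElem_zero c z hz
  obtain ⟨y, l, hl⟩ := List.exists_cons_of_ne_nil hne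
  have hy : y = z := by simpa [hl] using h0
  subst hy
  refine ⟨l, hl ▸ hnd, hl ▸ hf, ?_⟩
  rw [← hl, ← List.support_formPerm_of_nodup _ hnd (toList_ne_singleton c y), hf]

theorem IsCycle.swap_mul_mul {c d : Perm α} (hc : c.IsCycle) (hd : d.IsCycle) (h : Disjoint c d)
    {u v : α} (hu : u ∈ c.support) (hv : v ∈ d.support) :
    (swap u v * c * d).IsCycle ∧ (swap u v * c * d).support = c.support ∪ d.support := by
  obtain ⟨l, hl, rfl, hlc⟩ := hc.exists_formPerm_eq hu
  obtain ⟨k, hk, rfl, hkd⟩ := hd.exists_formPerm_eq hv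
  have hdis : List.Disjoint (u :: l) (v :: k) := by
    rw [disjoint_iff_disjoint_support, ← hlc, ← hkd] at h
    exact List.disjoint_toFinset_iff_disjoint.1 h
  have hnd : (u :: l ++ v :: k).Nodup := List.nodup_append'.2 ⟨hl, hk, hdis⟩
  rw [List.swap_mul_formPerm_mul_formPerm]
  · refine ⟨List.isCycle_formPerm hnd (by simp; lia), ?_⟩
    rw [List.support_formPerm_of_nodup _ hnd (by simp), List.toFinset_append, hlc, hkd]
  · exact List.nodup_cons.2 ⟨fun h' => hdis h' (by simp), hl⟩

/-- Choosing one point on each of a list of disjoint cycles, the cycle through the chosen points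
joins all of them into a single cycle. -/
theorem isCycle_formPerm_map_mul_prod (r : Perm α → α) (L : List (Perm α)) (hL : L ≠ [])
    (hc : ∀ c ∈ L, c.IsCycle) (hd : L.Pairwise Disjoint) (hr : ∀ c ∈ L, r c ∈ c.support) :
    ((L.map r).formPerm * L.prod).IsCycle ∧
      ((L.map r).formPerm * L.prod).support = L.prod.support := by
  induction L with
  | nil => exact absurd rfl hL
  | cons c L ih =>
    cases L with
    | nil => simpa using hc
    | cons e L =>
      obtain ⟨h1, h2⟩ := ih (by simp) (fun x hx => hc x (List.mem_cons_of_mem _ hx))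
        (List.pairwise_cons.1 hd).2 (fun x hx => hr x (List.mem_cons_of_mem _ hx))
      have hdis : Disjoint c (e :: L).prod :=
        disjoint_prod_right _ (List.pairwise_cons.1 hd).1
      have hdis' : Disjoint c (((e :: L).map r).formPerm * (e :: L).prod) := by
        rw [disjoint_iff_disjoint_support] at hdis ⊢
        rwa [h2]
      have he : r e ∈ (((e :: L).map r).formPerm * (e :: L).prod).support := by
        rw [h2]
        exact support_le_prod_of_mem (by simp) (List.pairwise_cons.1 hd).2 (hr e (by simp))
      -- The swap is the first factor of the joining cycle; disjointness lets `c` commute past the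
      -- rest to stand next to it.
      have key : ((c :: e :: L).map r).formPerm * (c :: e :: L).prod =
          swap (r c) (r e) * c * (((e :: L).map r).formPerm * (e :: L).prod) := by
        rw [mul_assoc _ c, hdis'.commute.eq, List.prod_cons, hdis.commute.eq]
        simp only [List.map_cons, List.formPerm_cons_cons, mul_assoc]
      rw [key]
      obtain ⟨h3, h4⟩ := (hc c (by simp)).swap_mul_mul h1 hdis' (hr c (by simp)) he
      refine ⟨h3, ?_⟩
      rw [h4, h2, List.prod_cons (a := c), hdis.support_mul]

/-- `U` meets every nontrivial cycle of `π` in exactly one point, and has no fixed points of `π`. -/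
def IsTransversal (π : Perm α) (U : Finset α) : Prop :=
  U ⊆ π.support ∧ ∀ x ∈ π.support, ∃! u, u ∈ U ∧ SameCycle π x u

theorem IsTransversal.inv {π : Perm α} {U : Finset α} (h : IsTransversal π U) :
    IsTransversal π⁻¹ U := by
  simpa [IsTransversal, sameCycle_inv] using h

/-- Disjoint cycles commute, so the factor through `u` may be listed last. This freedom fixes where
the joining cycle sends `u`. -/
theorem IsTransversal.exists_formPerm_mul_isCycle {π : Perm α} {U : Finset α}
    (h : IsTransversal π U) {u : α} (hu : u ∈ U) :
    ∃ l : List α, (l ++ [u]).Nodup ∧ (l ++ [u]).toFinset = U ∧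
      ((l ++ [u]).formPerm * π).IsCycle ∧ ((l ++ [u]).formPerm * π).support = π.support := by
  classical
  obtain ⟨L, hprod, hcyc, hdis⟩ := π.truncCycleFactors.out
  have hfac : ∀ c, c ∈ L ↔ c ∈ π.cycleFactorsFinset := by
    intro c
    have := (cycleFactorsFinset_eq_list_toFinset (σ := π)
      (nodup_of_pairwise_disjoint_cycles hcyc hdis)).2 ⟨hcyc, hdis, hprod⟩
    rw [this, List.mem_toFinset]
  have hsel : ∀ c ∈ L, ∃ v, v ∈ U ∧ v ∈ c.support ∧ ∀ w ∈ U, w ∈ c.support → w = v := by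
    intro c hc
    obtain ⟨x, hx⟩ := (hcyc c hc).nonempty_support
    have hcx := cycle_is_cycleOf hx ((hfac c).1 hc)
    have hxπ : x ∈ π.support := mem_cycleFactorsFinset_support_le ((hfac c).1 hc) hx
    obtain ⟨v, ⟨hvU, hv⟩, huniq⟩ := h.2 x hxπ
    refine ⟨v, hvU, ?_, fun w hw hwc => huniq w ⟨hw, ?_⟩⟩
    · rw [hcx, mem_support_cycleOf_iff]; exact ⟨hv, hxπ⟩
    · rw [hcx, mem_support_cycleOf_iff] at hwc; exact hwc.1
  have : Nonempty α := ⟨u⟩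
  choose! r hrU hrc huniq using hsel
  have huπ : u ∈ π.support := h.1 hu
  have hcu : π.cycleOf u ∈ L := (hfac _).2 (cycleOf_mem_cycleFactorsFinset_iff.2 huπ)
  have hperm : (L.erase (π.cycleOf u) ++ [π.cycleOf u]).Perm L :=
    (List.perm_append_singleton _ _).trans (List.perm_cons_erase hcu).symm
  set K := L.erase (π.cycleOf u) with hK
  have hmem : ∀ c, c ∈ K ++ [π.cycleOf u] ↔ c ∈ L := fun c => hperm.mem_iff
  have hdis' : (K ++ [π.cycleOf u]).Pairwise Disjoint := hdis.perm hperm.symm Disjoint.symm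
  have hprod' : (K ++ [π.cycleOf u]).prod = π := by
    exact (hperm.prod_eq' (hdis'.imp Disjoint.commute)).trans hprod
  have hru : r (π.cycleOf u) = u :=
    (huniq _ hcu u hu (mem_support_cycleOf_iff.2 ⟨SameCycle.refl _ _, huπ⟩)).symm
  have hmain := isCycle_formPerm_map_mul_prod r (K ++ [π.cycleOf u]) (by simp)
    (fun c hc => hcyc c ((hmem c).1 hc)) hdis' (fun c hc => hrc c ((hmem c).1 hc))
  rw [hprod', List.map_append, List.map_singleton, hru] at hmain
  refine ⟨K.map r, ?_, ?_, hmain⟩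
  · have : ((K ++ [π.cycleOf u]).map r).Nodup := by
      refine List.Nodup.map_on ?_ (nodup_of_pairwise_disjoint_cycles
        (fun c hc => hcyc c ((hmem c).1 hc)) hdis')
      intro c hc d hd hcd
      by_contra hne
      have hcd' := cycleFactorsFinset_pairwise_disjoint π ((hfac c).1 ((hmem c).1 hc))
        ((hfac d).1 ((hmem d).1 hd)) hne
      rw [disjoint_iff_disjoint_support] at hcd'
      exact Finset.disjoint_left.1 hcd' (hrc c ((hmem c).1 hc)) (hcd ▸ hrc d ((hmem d).1 hd))
    simpa [hru] using this
  · have : (K.map r ++ [u]) = (K ++ [π.cycleOf u]).map r := by simp [hru]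
    ext v
    rw [this, List.mem_toFinset, List.mem_map]
    constructor
    · rintro ⟨c, hc, rfl⟩
      exact hrU c ((hmem c).1 hc)
    · intro hv
      have hvπ := h.1 hv
      have hcv : π.cycleOf v ∈ L := (hfac _).2 (cycleOf_mem_cycleFactorsFinset_iff.2 hvπ)
      exact ⟨_, (hmem _).2 hcv,
        (huniq _ hcv v hv (mem_support_cycleOf_iff.2 ⟨SameCycle.refl _ _, hvπ⟩)).symm⟩

end Equiv.Perm

/-! ### Choosing transversals by Hall's theorem -/

/-- Sets have at least two points and fibres at most two, so Hall's condition holds with room to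
spare. Prescribing `w` costs at most one further point, and `2|T| - 1 ≤ 2|image|` still gives `|T| ≤
|image|`. Prescribing `a` costs nothing: the rest of its fibre is `b`, in a set already served. -/
theorem exists_injective_comp_of_card_fiber_le_two {α β ι : Type*} [DecidableEq α] [DecidableEq β]
    [Fintype ι] [DecidableEq ι] (s : ι → Finset α) (hs : Pairwise fun i j => Disjoint (s i) (s j))
    (hcard : ∀ i, 2 ≤ (s i).card) (p : α → β)
    (hp : ∀ y, ((Finset.univ.biUnion s).filter (p · = y)).card ≤ 2)
    {i₀ j₀ : ι} (hij : i₀ ≠ j₀) {a b w : α} (ha : a ∈ s i₀) (hb : b ∈ s j₀) (hw : w ∈ s j₀)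
    (hab : p a = p b) (hwa : p w ≠ p a) :
    ∃ g : ι → α, (∀ i, g i ∈ s i) ∧ Function.Injective (p ∘ g) ∧ g i₀ = a ∧ g j₀ = w := by
  have hmem : ∀ {i x}, x ∈ s i → x ∈ Finset.univ.biUnion s := fun {i x} hx =>
    Finset.mem_biUnion.2 ⟨i, Finset.mem_univ _, hx⟩
  have hne : ∀ {i j x y}, x ∈ s i → y ∈ s j → i ≠ j → x ≠ y := fun {i j x y} hx hy h e =>
    Finset.disjoint_left.1 (hs h) hx (e ▸ hy)
  let t : {i // i ≠ i₀ ∧ i ≠ j₀} → Finset β := fun i => ((s i).filter (p · ≠ p w)).image p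
  have ht : ∀ T : Finset {i // i ≠ i₀ ∧ i ≠ j₀}, T.card ≤ (T.biUnion t).card := by
    intro T
    set I := T.biUnion (fun i => s i) with hI
    have hIcard : 2 * T.card ≤ I.card := by
      rw [hI, Finset.card_biUnion (fun i _ j _ h => hs (fun e => h (Subtype.ext e))), mul_comm]
      exact Finset.card_nsmul_le_sum T _ 2 (fun i _ => hcard i)
    have hImem : ∀ x ∈ I, ∃ i, i ≠ j₀ ∧ x ∈ s i := by
      intro x hx
      obtain ⟨i, -, hx⟩ := Finset.mem_biUnion.1 hx
      exact ⟨i, i.2.2, hx⟩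
    -- `w` lies outside `I` and occupies one of the two places in its fibre.
    have hfib : (I.filter (p · = p w)).card ≤ 1 := by
      have hsub : insert w (I.filter (p · = p w)) ⊆ (Finset.univ.biUnion s).filter (p · = p w) := by
        intro x hx
        rw [Finset.mem_insert, Finset.mem_filter] at hx
        rcases hx with rfl | ⟨hx, hpx⟩
        · exact Finset.mem_filter.2 ⟨hmem hw, rfl⟩
        · obtain ⟨i, -, hx⟩ := hImem x hx
          exact Finset.mem_filter.2 ⟨hmem hx, hpx⟩
      have hwI : w ∉ I.filter (p · = p w) := fun h => by
        obtain ⟨i, hi, hx⟩ := hImem w (Finset.mem_filter.1 h).1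
        exact hne hx hw hi rfl
      have := (Finset.card_le_card hsub).trans (hp (p w))
      rw [Finset.card_insert_of_notMem hwI] at this
      lia
    have hsplit := Finset.card_filter_add_card_filter_not (s := I) (p · = p w)
    have himg : (I.filter (¬ p · = p w)).card ≤ 2 * ((I.filter (¬ p · = p w)).image p).card := by
      refine Finset.card_le_mul_card_image _ 2 fun y _ => (Finset.card_le_card ?_).trans (hp y)
      intro x hx
      simp only [Finset.mem_filter] at hx
      obtain ⟨i, -, hi⟩ := hImem x hx.1.1
      exact Finset.mem_filter.2 ⟨hmem hi, hx.2⟩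
    have hle : ((I.filter (¬ p · = p w)).image p).card ≤ (T.biUnion t).card := by
      refine Finset.card_le_card fun y hy => ?_
      obtain ⟨x, hx, rfl⟩ := Finset.mem_image.1 hy
      obtain ⟨hxI, hx⟩ := Finset.mem_filter.1 hx
      obtain ⟨i, hi, hxi⟩ := Finset.mem_biUnion.1 hxI
      exact Finset.mem_biUnion.2 ⟨i, hi, Finset.mem_image_of_mem _ (Finset.mem_filter.2 ⟨hxi, hx⟩)⟩
    lia
  obtain ⟨f, hf, hft⟩ := (Finset.all_card_le_biUnion_card_iff_exists_injective t).1 ht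
  have hf' : ∀ i : {i // i ≠ i₀ ∧ i ≠ j₀}, ∃ x, x ∈ s i ∧ p x = f i ∧ p x ≠ p w := by
    intro i
    obtain ⟨x, hx, hxf⟩ := Finset.mem_image.1 (hft i)
    exact ⟨x, (Finset.mem_filter.1 hx).1, hxf, (Finset.mem_filter.1 hx).2⟩
  choose g hgs hgf hgw using hf'
  -- The fibre of `p a` is already filled by `a` and `b`.
  have hga : ∀ i, p (g i) ≠ p a := by
    intro i h
    have hsub : {a, b, g i} ⊆ (Finset.univ.biUnion s).filter (p · = p a) := by
      intro x hx
      simp only [Finset.mem_insert, Finset.mem_singleton] at hx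
      rcases hx with rfl | rfl | rfl
      · exact Finset.mem_filter.2 ⟨hmem ha, rfl⟩
      · exact Finset.mem_filter.2 ⟨hmem hb, hab.symm⟩
      · exact Finset.mem_filter.2 ⟨hmem (hgs i), h⟩
    have := (Finset.card_le_card hsub).trans (hp (p a))
    rw [Finset.card_eq_three.2 ⟨a, b, g i, hne ha hb hij, hne ha (hgs i) i.2.1.symm,
      hne hb (hgs i) i.2.2.symm, rfl⟩] at this
    lia
  refine ⟨fun i => if h0 : i = i₀ then a else if h1 : i = j₀ then w else g ⟨i, h0, h1⟩,
    ?_, ?_, by simp, by simp [hij.symm]⟩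
  · intro i
    dsimp only
    split_ifs with h0 h1
    · exact h0 ▸ ha
    · exact h1 ▸ hw
    · exact hgs ⟨i, h0, h1⟩
  · intro i j h
    dsimp only [Function.comp] at h
    split_ifs at h with h0 h1 h2 h3 h4 h5 h6 h7
    · exact h0.trans h1.symm
    · exact absurd h.symm hwa
    · exact absurd h.symm (hga _)
    · exact absurd h hwa
    · exact h3.trans h5.symm
    · exact absurd h.symm (hgw _)
    · exact absurd h (hga _)
    · exact absurd h (hgw _)
    · rw [hgf, hgf] at h
      exact congrArg Subtype.val (hf h)

theorem Equiv.Perm.isTransversal_image {α : Type*} [DecidableEq α] [Fintype α] {π : Equiv.Perm α}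
    (g : π.cycleFactorsFinset → α) (hg : ∀ c, g c ∈ c.1.support) :
    π.IsTransversal (Finset.univ.image g) := by
  constructor
  · intro u hu
    obtain ⟨c, -, rfl⟩ := Finset.mem_image.1 hu
    exact mem_cycleFactorsFinset_support_le c.2 (hg c)
  · intro x hx
    have hx' : π.cycleOf x ∈ π.cycleFactorsFinset := cycleOf_mem_cycleFactorsFinset_iff.2 hx
    have hgx : g ⟨π.cycleOf x, hx'⟩ ∈ (π.cycleOf x).support := hg ⟨π.cycleOf x, hx'⟩
    refine ⟨g ⟨π.cycleOf x, hx'⟩,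
      ⟨Finset.mem_image_of_mem _ (Finset.mem_univ _), (mem_support_cycleOf_iff.1 hgx).1⟩, ?_⟩
    rintro u ⟨hu, hxu⟩
    obtain ⟨c, -, rfl⟩ := Finset.mem_image.1 hu
    refine congrArg g (Subtype.ext ?_)
    change c.1 = π.cycleOf x
    rw [hxu.cycleOf_eq]
    exact cycle_is_cycleOf (hg c) c.2

/-! ### Factoring balanced permutations into `p`-cycles -/

section

variable {m n : ℕ} {p : Fin m → Fin n}

theorem IsPBalanced.apply_ne {π : Equiv.Perm (Fin m)} (h : IsPBalanced p π) {x : Fin m}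
    (hx : x ∈ π.support) : p (π x) ≠ p x := fun e =>
  Equiv.Perm.mem_support.1 hx
    (h (Finset.mem_coe.2 (Equiv.Perm.apply_mem_support.2 hx)) (Finset.mem_coe.2 hx) e)

theorem IsPCycle.one : IsPCycle p 1 := ⟨Or.inl rfl, by simp [IsPBalanced]⟩

theorem isPCycle_of_isCycle {c : Equiv.Perm (Fin m)} (hc : c.IsCycle) (h : IsPBalanced p c) :
    IsPCycle p c := ⟨Or.inr hc, h⟩

theorem IsPBalanced.of_support_subset {σ τ : Equiv.Perm (Fin m)} (h : IsPBalanced p τ)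
    (hs : σ.support ⊆ τ.support) : IsPBalanced p σ := h.mono (Finset.coe_subset.2 hs)

theorem isPCycle_formPerm {l : List (Fin m)} (hl : l.Nodup)
    (h : Set.InjOn p {x | x ∈ l}) : IsPCycle p l.formPerm := by
  constructor
  · rcases Nat.lt_or_ge l.length 2 with h2 | h2
    · exact Or.inl ((List.formPerm_eq_one_iff _ hl).2 (by lia))
    · exact Or.inr (List.isCycle_formPerm hl h2)
  · exact h.mono fun x hx => by
      simpa using List.support_formPerm_le l (Finset.mem_coe.1 hx)

/-- A cycle through one point of each cycle of `π` fuses `π` into one cycle; its inverse is the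
second factor. -/
theorem IsPBalanced.exists_mul_isPCycle {π : Equiv.Perm (Fin m)} (h : IsPBalanced p π) :
    ∃ σ τ, IsPCycle p σ ∧ IsPCycle p τ ∧ τ * σ = π := by
  rcases eq_or_ne π 1 with rfl | hπ
  · exact ⟨1, 1, IsPCycle.one, IsPCycle.one, by simp⟩
  have hne : ∀ c : π.cycleFactorsFinset, ∃ x, x ∈ c.1.support := fun c =>
    (Equiv.Perm.mem_cycleFactorsFinset_iff.1 c.2).1.nonempty_support
  choose g hg using hne
  have hU := Equiv.Perm.isTransversal_image g hg
  obtain ⟨x, hx⟩ := Finset.nonempty_iff_ne_empty.2 (mt Equiv.Perm.support_eq_empty_iff.1 hπ)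
  obtain ⟨u, ⟨hu, -⟩, -⟩ := hU.2 x hx
  obtain ⟨l, hl, hlU, hcyc, hsupp⟩ := hU.exists_formPerm_mul_isCycle hu
  refine ⟨_, (l ++ [u]).reverse.formPerm, isPCycle_of_isCycle hcyc (h.of_support_subset hsupp.le),
    isPCycle_formPerm (List.nodup_reverse.2 hl) (h.mono ?_), ?_⟩
  · intro y hy
    refine Finset.mem_coe.2 (hU.1 ?_)
    rw [← hlU, List.mem_toFinset]
    exact List.mem_reverse.1 hy
  · rw [List.formPerm_reverse]
    group

/-- Since `τ` changes the `p`-value of each point it moves and `h` preserves `p`-values, `h` cannot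
bring such a point back. -/
theorem support_mul_eq_of_apply_ne {h τ : Equiv.Perm (Fin m)} (hp : ∀ x, p (h x) = p x)
    (hs : h.support ⊆ τ.support) (hτ : ∀ x ∈ τ.support, p (τ x) ≠ p x) :
    (h * τ).support = τ.support := by
  ext x
  constructor
  · intro hx
    by_contra hx'
    have h1 := Equiv.Perm.notMem_support.1 hx'
    have h2 := Equiv.Perm.notMem_support.1 (fun h' => hx' (hs h'))
    exact Equiv.Perm.mem_support.1 hx (by rw [Equiv.Perm.mul_apply, h1, h2])
  · intro hx
    refine Equiv.Perm.mem_support.2 fun e => hτ x hx ?_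
    rw [← hp, ← Equiv.Perm.mul_apply, e]

theorem exists_three_isPCycle {π₁ π₂ : Equiv.Perm (Fin m)}
    (h₁ : IsPBalanced p π₁) (h₂ : IsPBalanced p π₂) (hd : Disjoint π₁.support π₂.support) :
    ∃ σ₁ σ₂ σ₃ : Equiv.Perm (Fin m), IsPCycle p σ₁ ∧ IsPCycle p σ₂ ∧ IsPCycle p σ₃ ∧
      (σ₃ * σ₂ * σ₁).support = (π₂ * π₁).support ∧ p ∘ (σ₃ * σ₂ * σ₁) = p ∘ (π₂ * π₁) := by
  have hd' : π₁.Disjoint π₂ := Equiv.Perm.disjoint_iff_disjoint_support.2 hd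
  have hsupp : (π₂ * π₁).support = π₂.support ∪ π₁.support := hd'.symm.support_mul
  have hτ₁ : ∀ x ∈ π₁.support, (π₂ * π₁) x = π₁ x := fun x hx =>
    Equiv.Perm.notMem_support.1
      (Finset.disjoint_left.1 hd (Equiv.Perm.apply_mem_support.2 hx))
  have hτ₂ : ∀ x ∈ π₂.support, (π₂ * π₁) x = π₂ x := fun x hx => by
    rw [Equiv.Perm.mul_apply, Equiv.Perm.notMem_support.1 (Finset.disjoint_right.1 hd hx)]
  have hτ : ∀ x ∈ (π₂ * π₁).support, p ((π₂ * π₁) x) ≠ p x := by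
    intro x hx
    rcases Finset.mem_union.1 (hsupp ▸ hx) with hx | hx
    · rw [hτ₂ x hx]; exact h₂.apply_ne hx
    · rw [hτ₁ x hx]; exact h₁.apply_ne hx
  -- Without a shared `p`-value the product is itself balanced, and two `p`-cycles suffice.
  by_cases hshare : ∃ a ∈ π₁.support, ∃ b ∈ π₂.support, p a = p b
  swap
  · push Not at hshare
    have hbal : IsPBalanced p (π₂ * π₁) := by
      unfold IsPBalanced
      rw [hsupp]
      intro x hx y hy hxy
      rcases Finset.mem_union.1 (Finset.mem_coe.1 hx) with hx | hx <;>
        rcases Finset.mem_union.1 (Finset.mem_coe.1 hy) with hy | hy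
      · exact h₂ hx hy hxy
      · exact absurd hxy.symm (hshare y hy x hx)
      · exact absurd hxy (hshare x hx y hy)
      · exact h₁ hx hy hxy
    obtain ⟨σ, τ, hσ, hτ', e⟩ := hbal.exists_mul_isPCycle
    exact ⟨σ, τ, 1, hσ, hτ', IsPCycle.one, by simp [e], by simp [e]⟩
  obtain ⟨a, ha, b, hb, hab⟩ := hshare
  -- Chosen so that `c₂` below sends `b` through `w` to the head `v` of the list ending in `w`.
  set w := π₂⁻¹ b with hwdef
  have hπw : π₂ w = b := by simp [hwdef]
  have hw : w ∈ π₂.support := by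
    rw [← Equiv.Perm.apply_mem_support, hπw]; exact hb
  have hwa : p w ≠ p a := by
    rw [hab, ← hπw]; exact (h₂.apply_ne hw).symm
  let s : π₁.cycleFactorsFinset ⊕ π₂.cycleFactorsFinset → Finset (Fin m) :=
    Sum.elim (fun c => c.1.support) (fun c => c.1.support)
  have hs₁ : ∀ c : π₁.cycleFactorsFinset, c.1.support ⊆ π₁.support := fun c =>
    Equiv.Perm.mem_cycleFactorsFinset_support_le c.2
  have hs₂ : ∀ c : π₂.cycleFactorsFinset, c.1.support ⊆ π₂.support := fun c =>
    Equiv.Perm.mem_cycleFactorsFinset_support_le c.2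
  obtain ⟨g, hgs, hginj, hga, hgw⟩ := exists_injective_comp_of_card_fiber_le_two s
    (by
      rintro (c | c) (d | d) hcd
      · exact (π₁.cycleFactorsFinset_pairwise_disjoint c.2 d.2
          (fun e => hcd (congrArg _ (Subtype.ext e)))).disjoint_support
      · exact hd.mono (hs₁ c) (hs₂ d)
      · exact hd.symm.mono (hs₂ c) (hs₁ d)
      · exact (π₂.cycleFactorsFinset_pairwise_disjoint c.2 d.2
          (fun e => hcd (congrArg _ (Subtype.ext e)))).disjoint_support)
    (by
      rintro (c | c)
      · exact (Equiv.Perm.mem_cycleFactorsFinset_iff.1 c.2).1.two_le_card_support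
      · exact (Equiv.Perm.mem_cycleFactorsFinset_iff.1 c.2).1.two_le_card_support)
    p
    (by
      intro y
      have hsub : (Finset.univ.biUnion s).filter (p · = y) ⊆
          π₁.support.filter (p · = y) ∪ π₂.support.filter (p · = y) := by
        intro x hx
        obtain ⟨hx, hxy⟩ := Finset.mem_filter.1 hx
        obtain ⟨c | c, -, hxc⟩ := Finset.mem_biUnion.1 hx
        · exact Finset.mem_union_left _ (Finset.mem_filter.2 ⟨hs₁ c hxc, hxy⟩)
        · exact Finset.mem_union_right _ (Finset.mem_filter.2 ⟨hs₂ c hxc, hxy⟩)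
      have hone : ∀ {π : Equiv.Perm (Fin m)}, IsPBalanced p π →
          (π.support.filter (p · = y)).card ≤ 1 := by
        intro π h
        refine Finset.card_le_one.2 fun x hx z hz => ?_
        simp only [Finset.mem_filter] at hx hz
        exact h hx.1 hz.1 (hx.2.trans hz.2.symm)
      have h1 := hone h₁
      have h2 := hone h₂
      have := (Finset.card_le_card hsub).trans (Finset.card_union_le _ _)
      lia)
    (i₀ := Sum.inl ⟨π₁.cycleOf a, Equiv.Perm.cycleOf_mem_cycleFactorsFinset_iff.2 ha⟩)
    (j₀ := Sum.inr ⟨π₂.cycleOf b, Equiv.Perm.cycleOf_mem_cycleFactorsFinset_iff.2 hb⟩)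
    (by simp)
    (a := a) (b := b) (w := w)
    (Equiv.Perm.mem_support_cycleOf_iff.2 ⟨Equiv.Perm.SameCycle.refl _ _, ha⟩)
    (Equiv.Perm.mem_support_cycleOf_iff.2 ⟨Equiv.Perm.SameCycle.refl _ _, hb⟩)
    (Equiv.Perm.mem_support_cycleOf_iff.2
      ⟨⟨-1, by simp [hwdef]⟩, hb⟩)
    hab hwa
  have hU := Equiv.Perm.isTransversal_image (g ∘ Sum.inl) fun c => hgs (Sum.inl c)
  have hV := Equiv.Perm.isTransversal_image (g ∘ Sum.inr) fun c => hgs (Sum.inr c)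
  have haU : a ∈ Finset.univ.image (g ∘ Sum.inl) :=
    Finset.mem_image.2 ⟨_, Finset.mem_univ _, hga⟩
  have hwV : w ∈ Finset.univ.image (g ∘ Sum.inr) :=
    Finset.mem_image.2 ⟨_, Finset.mem_univ _, hgw⟩
  obtain ⟨l, hl, hlU, hlc, hls⟩ := hU.exists_formPerm_mul_isCycle haU
  -- Using `π₂⁻¹` puts the joining cycle on the right of `c₂⁻¹` in `π₂`, next to the one from `π₁`.
  obtain ⟨k, hk, hkV, hkc, hks⟩ := hV.inv.exists_formPerm_mul_isCycle hwV
  have hmeml : ∀ x, x ∈ l ++ [a] → x ∈ Set.range g ∧ x ∈ π₁.support := by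
    intro x hx
    have hx := hlU ▸ List.mem_toFinset.2 hx
    refine ⟨?_, hU.1 hx⟩
    obtain ⟨c, -, rfl⟩ := Finset.mem_image.1 hx
    exact ⟨_, rfl⟩
  have hmemk : ∀ x, x ∈ k ++ [w] → x ∈ Set.range g ∧ x ∈ π₂.support := by
    intro x hx
    have hx := hkV ▸ List.mem_toFinset.2 hx
    refine ⟨?_, hV.1 hx⟩
    obtain ⟨c, -, rfl⟩ := Finset.mem_image.1 hx
    exact ⟨_, rfl⟩
  obtain ⟨v, k', hvk⟩ : ∃ v k', k ++ [w] = v :: k' :=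
    List.exists_cons_of_ne_nil (by simp)
  have hlast : (k ++ [w]).formPerm w = v := by
    have h1 := List.formPerm_apply_getLast v k'
    have h2 : (v :: k').getLast (by simp) = w := by simp [← hvk]
    rwa [h2, ← hvk] at h1
  set c₁ := (l ++ [a]).formPerm * π₁ with hc₁
  set c₂ := (k ++ [w]).formPerm * π₂⁻¹ with hc₂
  have hc₂b : c₂ b = v := by
    rw [hc₂, Equiv.Perm.mul_apply, ← hwdef, hlast]
  have hc₂a : c₂ a = a := by
    rw [← Equiv.Perm.notMem_support, hks, Equiv.Perm.support_inv]
    exact Finset.disjoint_left.1 hd ha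
  have hnd : (v :: a :: l.reverse).Nodup := by
    refine List.nodup_cons.2 ⟨fun hv => ?_, by simpa using List.nodup_reverse.2 hl⟩
    have h1 := (hmeml v (by simpa [or_comm] using hv)).2
    have h2 := (hmemk v (by rw [hvk]; simp)).2
    exact Finset.disjoint_left.1 hd h1 h2
  have hrev : (l ++ [a]).reverse = a :: l.reverse := by simp
  have hdisj : List.Disjoint (a :: l.reverse) (v :: k') := by
    intro x hx hx'
    have h1 := (hmeml x (by simpa [or_comm] using hx)).2
    have h2 := (hmemk x (by rw [hvk]; exact hx')).2
    exact Finset.disjoint_left.1 hd h1 h2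
  have hnd' : (a :: l.reverse ++ v :: k').Nodup :=
    List.nodup_append'.2 ⟨(List.nodup_cons.1 hnd).2, hvk ▸ hk, hdisj⟩
  have hP₁ : π₁ = (a :: l.reverse).formPerm * c₁ := by
    rw [← hrev, List.formPerm_reverse, hc₁]; group
  have hP₂ : π₂ = c₂⁻¹ * (v :: k').formPerm := by
    rw [← hvk, hc₂]; group
  have hcomm : (v :: k').formPerm * (a :: l.reverse).formPerm =
      (a :: l.reverse).formPerm * (v :: k').formPerm := by
    refine Equiv.Perm.Disjoint.commute ?_
    rw [Equiv.Perm.disjoint_iff_disjoint_support]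
    exact (List.disjoint_toFinset_iff_disjoint.2 hdisj.symm).mono
      (List.support_formPerm_le _) (List.support_formPerm_le _)
  have hkey : c₂⁻¹ * (a :: l.reverse ++ v :: k').formPerm * c₁ =
      Equiv.swap a b * (π₂ * π₁) := by
    -- `c₂` fixes `a` and sends `b` to `v`, so it conjugates one swap into the other.
    have hsw : Equiv.swap a b * c₂⁻¹ = c₂⁻¹ * Equiv.swap a v := by
      rw [Equiv.mul_swap_eq_swap_mul]
      congr 2
      · rw [Equiv.Perm.eq_inv_iff_eq, hc₂a]
      · rw [Equiv.Perm.eq_inv_iff_eq, hc₂b]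
    calc c₂⁻¹ * (a :: l.reverse ++ v :: k').formPerm * c₁
        = c₂⁻¹ * Equiv.swap a v * ((a :: l.reverse).formPerm * (v :: k').formPerm) * c₁ := by
          rw [← List.swap_mul_formPerm_mul_formPerm hnd]; simp only [mul_assoc]
      _ = Equiv.swap a b * ((c₂⁻¹ * (v :: k').formPerm) * ((a :: l.reverse).formPerm * c₁)) := by
          rw [← hsw, ← hcomm]; simp only [mul_assoc]
      _ = Equiv.swap a b * (π₂ * π₁) := by rw [← hP₁, ← hP₂]
  have hpsw : ∀ x, p (Equiv.swap a b x) = p x := by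
    intro x
    rw [Equiv.swap_apply_def]
    split_ifs with h1 h2
    · rw [h1, hab]
    · rw [h2, hab]
    · rfl
  refine ⟨c₁, (a :: l.reverse ++ v :: k').formPerm, c₂⁻¹,
    isPCycle_of_isCycle hlc (h₁.of_support_subset hls.le), isPCycle_formPerm hnd' ?_,
    isPCycle_of_isCycle hkc.inv (h₂.of_support_subset (by simp [hks])), ?_, ?_⟩
  · have hr : ∀ x ∈ a :: l.reverse ++ v :: k', x ∈ Set.range g := by
      intro x hx
      rcases List.mem_append.1 hx with hx | hx
      · exact (hmeml x (by simpa [or_comm] using hx)).1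
      · exact (hmemk x (hvk ▸ hx)).1
    intro x hx y hy hxy
    obtain ⟨i, rfl⟩ := hr x hx
    obtain ⟨j, rfl⟩ := hr y hy
    exact congrArg g (hginj hxy)
  · rw [hkey]
    refine support_mul_eq_of_apply_ne hpsw ?_ hτ
    rcases eq_or_ne a b with rfl | hne
    · simp
    · rw [Equiv.Perm.support_swap hne, hsupp]
      intro x hx
      rcases Finset.mem_insert.1 hx with rfl | hx
      · exact Finset.mem_union_right _ ha
      · rw [Finset.mem_singleton.1 hx]; exact Finset.mem_union_left _ hb
  · rw [hkey]
    funext x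
    exact hpsw _

end

/-! ### Vertices and edges of the partition polytope -/

section

variable {m n : ℕ}

/-- The 0/1 matrix recording which item `j` is assigned to which cluster `f j`. -/
def assignmentMatrix (f : Fin m → Fin n) : Fin n → Fin m → ℝ := fun i j => if f j = i then 1 else 0

/-- The cluster `i` receives exactly `κ i` items under the assignment `f`. -/
def HasFiberCards (κ : Fin n → ℕ) (f : Fin m → Fin n) : Prop :=
  ∀ i, (Finset.univ.filter (f · = i)).card = κ i

theorem HasFiberCards.comp_perm {κ : Fin n → ℕ} {f : Fin m → Fin n} (h : HasFiberCards κ f)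
    (σ : Equiv.Perm (Fin m)) : HasFiberCards κ (f ∘ σ) := by
  intro i
  rw [← h i]
  exact Finset.card_equiv σ (by simp)

theorem sum_row_assignmentMatrix (f : Fin m → Fin n) (i : Fin n) :
    ∑ j, assignmentMatrix f i j = ((Finset.univ.filter (f · = i)).card : ℝ) := by
  simp [assignmentMatrix]

theorem assignmentMatrix_mem_iff {κ : Fin n → ℕ} {f : Fin m → Fin n} :
    assignmentMatrix f ∈ partitionPolytope m κ ↔ HasFiberCards κ f := by
  constructor
  · intro h i
    have := h.1 i
    rw [sum_row_assignmentMatrix] at this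
    exact_mod_cast this
  · intro h
    refine ⟨fun i => ?_, fun j => by simp [assignmentMatrix], fun i j => ?_⟩
    · rw [sum_row_assignmentMatrix, h i]
    · unfold assignmentMatrix; split_ifs <;> norm_num

theorem convex_partitionPolytope (κ : Fin n → ℕ) : Convex ℝ (partitionPolytope m κ) := by
  rintro x hx z hz a b ha hb hab
  refine ⟨fun i => ?_, fun j => ?_, fun i j => ?_⟩
  · simp only [Pi.add_apply, Pi.smul_apply, smul_eq_mul, Finset.sum_add_distrib,
      ← Finset.mul_sum, hx.1, hz.1]
    rw [← add_mul, hab, one_mul]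
  · simp only [Pi.add_apply, Pi.smul_apply, smul_eq_mul, Finset.sum_add_distrib,
      ← Finset.mul_sum, hx.2.1, hz.2.1]
    rw [← add_mul, hab, one_mul]
  · exact add_nonneg (mul_nonneg ha (hx.2.2 i j)) (mul_nonneg hb (hz.2.2 i j))

theorem assignmentMatrix_injective :
    Function.Injective (assignmentMatrix : (Fin m → Fin n) → Fin n → Fin m → ℝ) := by
  intro f g h
  funext j
  have := congrFun (congrFun h (f j)) j
  by_contra hne
  simp [assignmentMatrix, Ne.symm hne] at this

/-- An element of the polytope that vanishes wherever `assignmentMatrix f` does is equal to it. -/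
theorem eq_assignmentMatrix_of_forall {κ : Fin n → ℕ} {f : Fin m → Fin n} {x : Fin n → Fin m → ℝ}
    (hx : x ∈ partitionPolytope m κ) (h : ∀ i j, f j ≠ i → x i j = 0) : x = assignmentMatrix f := by
  funext i j
  unfold assignmentMatrix
  split_ifs with hf
  · subst hf
    rw [← hx.2.1 j]
    exact (Finset.sum_eq_single_of_mem _ (Finset.mem_univ _) fun i _ hi => h i j hi.symm).symm
  · exact h i j hf

theorem assignmentMatrix_mem_extremePoints {κ : Fin n → ℕ} {f : Fin m → Fin n}
    (hf : HasFiberCards κ f) :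
    assignmentMatrix f ∈ (partitionPolytope m κ).extremePoints ℝ := by
  refine ⟨assignmentMatrix_mem_iff.2 hf, ?_⟩
  rintro x hx y hy ⟨a, b, ha, hb, -, hxy⟩
  refine eq_assignmentMatrix_of_forall hx fun i j hij => ?_
  have h := congrFun (congrFun hxy i) j
  simp only [Pi.add_apply, Pi.smul_apply, smul_eq_mul, assignmentMatrix, if_neg hij] at h
  have h1 := mul_nonneg ha.le (hx.2.2 i j)
  have h2 := mul_nonneg hb.le (hy.2.2 i j)
  have h3 : a * x i j = 0 := by linarith
  exact (mul_eq_zero.1 h3).resolve_left ha.ne'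

theorem exists_hasFiberCards {κ : Fin n → ℕ} (hκ : ∑ i, κ i = m) :
    ∃ q : Fin m → Fin n, HasFiberCards κ q := by
  have e : (Σ i, Fin (κ i)) ≃ Fin m := Fintype.equivFinOfCardEq (by simp [hκ])
  refine ⟨fun j => (e.symm j).1, fun i => ?_⟩
  rw [← Fintype.card_fin (κ i), ← Fintype.card_subtype]
  exact Fintype.card_congr ((e.symm.subtypeEquiv fun _ => Iff.rfl).trans
    (Equiv.sigmaSubtype i))

/-- Splitting row `i` into `κ i` equal rows gives a doubly stochastic matrix. Birkhoff's theorem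
decomposes it into permutations, and regrouping rows turns these into assignments. -/
theorem partitionPolytope_subset_convexHull {κ : Fin n → ℕ} (hκ : ∑ i, κ i = m) :
    partitionPolytope m κ ⊆ convexHull ℝ (assignmentMatrix '' {f | HasFiberCards κ f}) := by
  intro y hy
  obtain ⟨q, hq⟩ := exists_hasFiberCards hκ
  have hq0 : ∀ k, (κ (q k) : ℝ) ≠ 0 := by
    intro k
    rw [← hq (q k)]
    exact_mod_cast (Finset.card_pos.2 ⟨k, by simp⟩).ne'
  have hsplit : ∀ i j, ∑ k, (if q k = i then y i j / κ i else 0) = y i j := by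
    intro i j
    rw [← Finset.sum_filter, Finset.sum_const, hq i, nsmul_eq_mul]
    -- An empty cluster has a zero row, which agrees with division by zero being `0`.
    by_cases h0 : κ i = 0
    · have h1 := hy.1 i
      rw [h0, Nat.cast_zero] at h1
      rw [h0, (Finset.sum_eq_zero_iff_of_nonneg fun j _ => hy.2.2 i j).1 h1 j (Finset.mem_univ _)]
      simp
    · field_simp
  let D : Matrix (Fin m) (Fin m) ℝ := Matrix.of fun k j => y (q k) j / κ (q k)
  have hD : D ∈ doublyStochastic ℝ (Fin m) := by
    rw [mem_doublyStochastic_iff_sum]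
    refine ⟨fun k j => div_nonneg (hy.2.2 _ _) (Nat.cast_nonneg _), fun k => ?_, fun j => ?_⟩
    · simp only [D, Matrix.of_apply]
      rw [← Finset.sum_div, hy.1, div_self (hq0 k)]
    · rw [← hy.2.1 j]
      rw [Finset.sum_congr rfl fun i _ => (hsplit i j).symm, Finset.sum_comm]
      refine Finset.sum_congr rfl fun k _ => ?_
      simp [D]
  obtain ⟨w, hw0, hw1, hw⟩ := exists_eq_sum_perm_of_mem_doublyStochastic hD
  refine mem_convexHull_of_exists_fintype w (fun σ => assignmentMatrix (q ∘ ⇑σ⁻¹)) hw0 hw1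
    (fun σ => ⟨_, hq.comp_perm σ⁻¹, rfl⟩) ?_
  funext i j
  have hentry : ∀ k, D k j = ∑ σ : Equiv.Perm (Fin m), w σ * if σ k = j then 1 else 0 := by
    intro k
    rw [← hw, Matrix.sum_apply]
    refine Finset.sum_congr rfl fun σ _ => ?_
    simp [PEquiv.toMatrix_apply, Equiv.toPEquiv_apply]
  have hy' : y i j = ∑ k, if q k = i then D k j else 0 := by
    rw [← hsplit i j]
    refine Finset.sum_congr rfl fun k _ => ?_
    split_ifs with h
    · simp [D, h]
    · rfl
  rw [hy', Finset.sum_apply, Finset.sum_apply]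
  simp only [hentry, Pi.smul_apply, smul_eq_mul]
  have : ∀ k, (if q k = i then ∑ σ : Equiv.Perm (Fin m), w σ * (if σ k = j then (1 : ℝ) else 0)
      else 0) = ∑ σ : Equiv.Perm (Fin m), w σ * (if k = σ⁻¹ j then if q k = i then 1 else 0 else 0)
      := by
    intro k
    simp only [Equiv.Perm.eq_inv_iff_eq]
    split_ifs <;> simp
  simp only [this]
  rw [Finset.sum_comm]
  refine Finset.sum_congr rfl fun σ _ => ?_
  rw [← Finset.mul_sum, Finset.sum_ite_eq' Finset.univ (σ⁻¹ j), if_pos (Finset.mem_univ _)]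
  rfl

theorem exists_eq_assignmentMatrix {κ : Fin n → ℕ} (hκ : ∑ i, κ i = m) {y : Fin n → Fin m → ℝ}
    (hy : y ∈ (partitionPolytope m κ).extremePoints ℝ) :
    ∃ f, HasFiberCards κ f ∧ assignmentMatrix f = y := by
  have hsub : convexHull ℝ (assignmentMatrix '' {f | HasFiberCards κ f}) ⊆ partitionPolytope m κ := by
    refine convexHull_min ?_ (convex_partitionPolytope κ)
    rintro _ ⟨f, hf, rfl⟩
    exact assignmentMatrix_mem_iff.2 hf
  rw [(partitionPolytope_subset_convexHull hκ).antisymm hsub] at hy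
  obtain ⟨f, hf, hfy⟩ := extremePoints_convexHull_subset hy
  exact ⟨f, hf, hfy⟩

/-- The functional that is maximized over the polytope by the matrices supported on the entries
`(f j, j)` and `(g j, j)`. -/
noncomputable def pairFunctional (f g : Fin m → Fin n) : StrongDual ℝ (Fin n → Fin m → ℝ) :=
  LinearMap.toContinuousLinearMap
    (-∑ i, ∑ j, if f j ≠ i ∧ g j ≠ i then
      (LinearMap.proj j : (Fin m → ℝ) →ₗ[ℝ] ℝ) ∘ₗ LinearMap.proj (R := ℝ) (φ := fun _ => Fin m → ℝ) i
      else 0)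

theorem pairFunctional_apply (f g : Fin m → Fin n) (y : Fin n → Fin m → ℝ) :
    pairFunctional f g y = -∑ i, ∑ j, if f j ≠ i ∧ g j ≠ i then y i j else 0 := by
  simp only [pairFunctional, LinearMap.coe_toContinuousLinearMap', LinearMap.neg_apply,
    LinearMap.sum_apply]
  congr 1
  refine Finset.sum_congr rfl fun i _ => Finset.sum_congr rfl fun j _ => ?_
  split_ifs <;> rfl

/-- The functional is minus a sum of nonnegative entries, and its maximum `0` is attained at `f`. -/
theorem setOf_isMax_pairFunctional {κ : Fin n → ℕ} {f g : Fin m → Fin n} (hf : HasFiberCards κ f) :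
    {x ∈ partitionPolytope m κ | ∀ y ∈ partitionPolytope m κ,
      pairFunctional f g y ≤ pairFunctional f g x} =
    {x ∈ partitionPolytope m κ | ∀ i j, f j ≠ i → g j ≠ i → x i j = 0} := by
  have hterm : ∀ x ∈ partitionPolytope m κ, ∀ i j,
      0 ≤ if f j ≠ i ∧ g j ≠ i then x i j else (0 : ℝ) := by
    intro x hx i j
    split_ifs
    · exact hx.2.2 i j
    · exact le_rfl
  have hzero : ∀ x : Fin n → Fin m → ℝ, (∀ i j, f j ≠ i → g j ≠ i → x i j = 0) →
      pairFunctional f g x = 0 := by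
    intro x hx
    rw [pairFunctional_apply, neg_eq_zero]
    refine Finset.sum_eq_zero fun i _ => Finset.sum_eq_zero fun j _ => ?_
    split_ifs with h
    · exact hx i j h.1 h.2
    · rfl
  ext x
  refine and_congr_right fun hx => ⟨fun h i j hi hj => ?_, fun h y hy => ?_⟩
  · have h1 := h _ (assignmentMatrix_mem_iff.2 hf)
    rw [hzero (assignmentMatrix f) fun i j h _ => if_neg h, pairFunctional_apply] at h1
    have h2 := (Finset.sum_eq_zero_iff_of_nonneg fun i _ =>
      Finset.sum_nonneg fun j _ => hterm x hx i j).1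
      (le_antisymm (by linarith) (Finset.sum_nonneg fun i _ =>
        Finset.sum_nonneg fun j _ => hterm x hx i j)) i (Finset.mem_univ _)
    have h3 := (Finset.sum_eq_zero_iff_of_nonneg fun j _ => hterm x hx i j).1 h2 j
      (Finset.mem_univ _)
    rwa [if_pos ⟨hi, hj⟩] at h3
  · rw [hzero x h, pairFunctional_apply, neg_nonpos]
    exact Finset.sum_nonneg fun i _ => Finset.sum_nonneg fun j _ => hterm y hy i j

/-- Column sums leave one parameter per moved item, and row sums equate the parameters of `j` and `σ
j`. As `σ` is one cycle, a single parameter remains. -/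
theorem mem_segment_of_isCycle {κ : Fin n → ℕ} {f : Fin m → Fin n} (hf : HasFiberCards κ f)
    {σ : Equiv.Perm (Fin m)} (hσ : σ.IsCycle) (hbal : IsPBalanced f σ) {x : Fin n → Fin m → ℝ}
    (hx : x ∈ partitionPolytope m κ) (h : ∀ i j, f j ≠ i → f (σ j) ≠ i → x i j = 0) :
    x ∈ segment ℝ (assignmentMatrix f) (assignmentMatrix (f ∘ σ)) := by
  have hcol : ∀ j, f (σ j) ≠ f j → x (f j) j + x (f (σ j)) j = 1 := by
    intro j hj
    rw [← hx.2.1 j]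
    exact (Fintype.sum_eq_add _ _ hj.symm fun i hi => h i j hi.1.symm hi.2.symm).symm
  have hfix : ∀ j, f (σ j) = f j → x (f j) j = 1 := by
    intro j hj
    rw [← hx.2.1 j]
    exact (Finset.sum_eq_single_of_mem _ (Finset.mem_univ _)
      fun i _ hi => h i j hi.symm (hj ▸ hi.symm)).symm
  have hstep : ∀ j ∈ σ.support, x (f (σ j)) (σ j) = x (f j) j := by
    intro j hj
    have hσj : σ j ∈ σ.support := Equiv.Perm.apply_mem_support.2 hj
    have hne := hbal.apply_ne hj
    -- Row `f (σ j)` of `x` and of the vertex have equal sums, and they can differ only in columns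
    -- `j` and `σ j`.
    have h0 : ∑ k, (x (f (σ j)) k - assignmentMatrix f (f (σ j)) k) = 0 := by
      rw [Finset.sum_sub_distrib, hx.1, (assignmentMatrix_mem_iff.2 hf).1, sub_self]
    rw [Fintype.sum_eq_add j (σ j) (Equiv.Perm.mem_support.1 hj).symm] at h0
    · have h1 := hcol j hne
      simp only [assignmentMatrix, if_neg hne.symm, if_true] at h0
      linarith
    · rintro k ⟨hkj, hkσ⟩
      unfold assignmentMatrix
      by_cases hk : k ∈ σ.support
      · have h1 : f k ≠ f (σ j) := fun e => hkσ (hbal hk hσj e)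
        have h2 : f (σ k) ≠ f (σ j) := fun e =>
          hkj (σ.injective (hbal (Finset.mem_coe.2 (Equiv.Perm.apply_mem_support.2 hk)) hσj e))
        rw [if_neg h1, h _ _ h1 h2, sub_zero]
      · have hk' := Equiv.Perm.notMem_support.1 hk
        split_ifs with h1
        · rw [← h1, hfix k (by rw [hk']), sub_self]
        · rw [h _ _ h1 (by rwa [hk']), sub_zero]
  obtain ⟨j₀, hj₀⟩ := hσ.nonempty_support
  have hconst : ∀ j ∈ σ.support, x (f j) j = x (f j₀) j₀ := by
    intro j hj
    obtain ⟨k, rfl⟩ := hσ.exists_pow_eq (Equiv.Perm.mem_support.1 hj₀) (Equiv.Perm.mem_support.1 hj)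
    clear hj
    induction k with
    | zero => rfl
    | succ k ih =>
      rw [pow_succ', Equiv.Perm.mul_apply, hstep _ (Equiv.Perm.pow_apply_mem_support.2 hj₀), ih]
  have hle : x (f j₀) j₀ ≤ 1 := by
    rw [← hcol j₀ (hbal.apply_ne hj₀)]
    linarith [hx.2.2 (f (σ j₀)) j₀]
  refine ⟨x (f j₀) j₀, 1 - x (f j₀) j₀, hx.2.2 _ _, by linarith, by ring, ?_⟩
  funext i j
  simp only [Pi.add_apply, Pi.smul_apply, smul_eq_mul, assignmentMatrix, Function.comp]
  by_cases hj : j ∈ σ.support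
  · have hne := hbal.apply_ne hj
    have h1 := hcol j hne
    rw [← hconst j hj]
    by_cases hi : f j = i
    · subst hi; rw [if_pos rfl, if_neg hne]; ring
    · by_cases hi' : f (σ j) = i
      · subst hi'; rw [if_neg hi, if_pos rfl]; linarith
      · rw [if_neg hi, if_neg hi', h i j hi hi']; ring
  · have hj' := Equiv.Perm.notMem_support.1 hj
    simp only [hj']
    split_ifs with hi
    · subst hi; rw [hfix j (by rw [hj'])]; ring
    · rw [h i j hi (by rwa [hj'])]; ring

theorem isExposed_segment_of_isCycle {κ : Fin n → ℕ} {f : Fin m → Fin n} (hf : HasFiberCards κ f)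
    {σ : Equiv.Perm (Fin m)} (hσ : σ.IsCycle) (hbal : IsPBalanced f σ) :
    IsExposed ℝ (partitionPolytope m κ)
      (segment ℝ (assignmentMatrix f) (assignmentMatrix (f ∘ σ))) := by
  refine fun _ => ⟨pairFunctional f (f ∘ σ), ?_⟩
  rw [setOf_isMax_pairFunctional hf]
  refine subset_antisymm ?_ fun x hx => mem_segment_of_isCycle hf hσ hbal hx.1 hx.2
  have hf' := assignmentMatrix_mem_iff.2 hf
  have hg' := assignmentMatrix_mem_iff.2 (hf.comp_perm σ)
  intro x hx
  refine ⟨(convex_partitionPolytope κ).segment_subset hf' hg' hx, fun i j hi hj => ?_⟩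
  obtain ⟨a, b, -, -, -, rfl⟩ := hx
  simp only [Pi.add_apply, Pi.smul_apply, assignmentMatrix, if_neg hi, if_neg hj]
  simp

/-- The vertex of the partition polytope given by an assignment. -/
def assignmentVertex {κ : Fin n → ℕ} (f : Fin m → Fin n) (hf : HasFiberCards κ f) :
    (partitionPolytope m κ).extremePoints ℝ :=
  ⟨assignmentMatrix f, assignmentMatrix_mem_extremePoints hf⟩

theorem edist_assignmentVertex_comp_le_one {κ : Fin n → ℕ} {f : Fin m → Fin n}
    (hf : HasFiberCards κ f) {σ : Equiv.Perm (Fin m)} (hσ : IsPCycle f σ) :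
    (polytopeGraph (partitionPolytope m κ)).edist (assignmentVertex f hf)
      (assignmentVertex (f ∘ σ) (hf.comp_perm σ)) ≤ 1 := by
  by_cases he : assignmentVertex f hf = assignmentVertex (f ∘ σ) (hf.comp_perm σ)
  · rw [← he, SimpleGraph.edist_self]; exact bot_le
  · have hσ1 : σ.IsCycle := by
      refine hσ.1.resolve_left ?_
      rintro rfl
      exact he rfl
    have hadj : (polytopeGraph (partitionPolytope m κ)).Adj (assignmentVertex f hf)
      (assignmentVertex (f ∘ σ) (hf.comp_perm σ)) :=
        ⟨he, isExposed_segment_of_isCycle hf hσ1 hσ.2⟩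
    exact (SimpleGraph.edist_eq_one_iff_adj.2 hadj).le

/-- An edge of the partition polytope has no assignment strictly between its two ends. -/
theorem eq_or_eq_of_adj {κ : Fin n → ℕ} {f g h : Fin m → Fin n} (hf : HasFiberCards κ f)
    (hg : HasFiberCards κ g) (hh : HasFiberCards κ h)
    (hadj : (polytopeGraph (partitionPolytope m κ)).Adj (assignmentVertex f hf)
      (assignmentVertex g hg))
    (hfg : ∀ j, h j = f j ∨ h j = g j) : h = f ∨ h = g := by
  have hf' := assignmentMatrix_mem_iff.2 hf
  have hg' := assignmentMatrix_mem_iff.2 hg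
  have hh' := assignmentMatrix_mem_iff.2 hh
  -- The reflection of `h` in the midpoint of the edge stays in the polytope, so extremality of the
  -- edge forces `h` onto it.
  set z : Fin n → Fin m → ℝ := assignmentMatrix f + assignmentMatrix g - assignmentMatrix h with hz
  have hzP : z ∈ partitionPolytope m κ := by
    refine ⟨fun i => ?_, fun j => ?_, fun i j => ?_⟩
    · simp only [hz, Pi.add_apply, Pi.sub_apply, Finset.sum_add_distrib, Finset.sum_sub_distrib,
        hf'.1, hg'.1, hh'.1]
      ring
    · simp only [hz, Pi.add_apply, Pi.sub_apply, Finset.sum_add_distrib, Finset.sum_sub_distrib,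
        hf'.2.1, hg'.2.1, hh'.2.1]
      ring
    · simp only [hz, Pi.add_apply, Pi.sub_apply, assignmentMatrix]
      rcases hfg j with e | e <;> rw [e] <;> split_ifs <;> norm_num
  have hmid : (1 / 2 : ℝ) • assignmentMatrix f + (1 / 2 : ℝ) • assignmentMatrix g ∈
      segment ℝ (assignmentMatrix f) (assignmentMatrix g) :=
    ⟨1 / 2, 1 / 2, by norm_num, by norm_num, by norm_num, rfl⟩
  have hmid' : (1 / 2 : ℝ) • assignmentMatrix f + (1 / 2 : ℝ) • assignmentMatrix g ∈
      openSegment ℝ (assignmentMatrix h) z :=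
    ⟨1 / 2, 1 / 2, by norm_num, by norm_num, by norm_num, by
      rw [hz, ← smul_add, ← smul_add]; congr 1; abel⟩
  obtain ⟨a, b, ha, hb, -, hab⟩ := hadj.2.isExtreme.left_mem_of_mem_openSegment hh' hzP hmid hmid'
  by_contra hcon
  push Not at hcon
  obtain ⟨j, hj⟩ := Function.ne_iff.1 hcon.1
  obtain ⟨k, hk⟩ := Function.ne_iff.1 hcon.2
  have h1 := congrFun (congrFun hab (f j)) j
  have h2 := congrFun (congrFun hab (g k)) k
  have h3 := congrFun (congrFun hab (h j)) j
  simp only [Pi.add_apply, Pi.smul_apply, smul_eq_mul, assignmentVertex, assignmentMatrix,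
    if_true, if_neg hj, if_neg hk, if_neg hj.symm] at h1 h2 h3
  have ha0 : a = 0 := by
    split_ifs at h1 <;> linarith
  have hb0 : b = 0 := by
    split_ifs at h2 <;> linarith
  rw [ha0, hb0] at h3
  norm_num at h3

end

/-! ### Decomposing a change of assignment; the upper bound -/

section

variable {m n : ℕ}

theorem exists_perm_comp_eq_on {α β : Type*} [Fintype α] [DecidableEq α] [DecidableEq β]
    (J : Finset α) (f g : α → β)
    (h : ∀ y, (J.filter (f · = y)).card = (J.filter (g · = y)).card) :
    ∃ π : Equiv.Perm α, π.support ⊆ J ∧ ∀ x ∈ J, f (π x) = g x := by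
  have hcard : ∀ (k : α → β) y, Fintype.card {a : J // k a = y} = (J.filter (k · = y)).card := by
    intro k y
    rw [← Fintype.card_coe]
    exact Fintype.card_congr
      ((Equiv.subtypeSubtypeEquivSubtypeInter (· ∈ J) (k · = y)).trans
        (Equiv.subtypeEquivRight fun x => by simp))
  have e : ∀ y, {a : J // g a = y} ≃ {a : J // f a = y} := fun y =>
    Fintype.equivOfCardEq (by rw [hcard g, hcard f, h y])
  let π : Equiv.Perm J := Equiv.ofFiberEquiv (f := fun a : J => g a) (g := fun a : J => f a) e
  refine ⟨Equiv.Perm.ofSubtype π, fun x hx => ?_, fun x hx => ?_⟩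
  · by_contra hxJ
    exact Equiv.Perm.mem_support.1 hx (Equiv.Perm.ofSubtype_apply_of_not_mem π hxJ)
  · rw [Equiv.Perm.ofSubtype_apply_of_mem π hx]
    exact Equiv.ofFiberEquiv_map e ⟨x, hx⟩

theorem exists_perm_pos_of_mem_doublyStochastic {ι : Type*} [Fintype ι] [DecidableEq ι]
    {M : Matrix ι ι ℝ} (hM : M ∈ doublyStochastic ℝ ι) : ∃ ρ : Equiv.Perm ι, ∀ i, 0 < M i (ρ i) := by
  obtain ⟨w, hw0, hw1, hw⟩ := exists_eq_sum_perm_of_mem_doublyStochastic hM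
  obtain ⟨ρ, -, hρ⟩ : ∃ ρ ∈ Finset.univ, 0 < w ρ :=
    Finset.exists_lt_of_sum_lt (f := fun _ => (0 : ℝ)) (by simp [hw1])
  refine ⟨ρ, fun i => ?_⟩
  rw [← hw, Matrix.sum_apply]
  refine Finset.sum_pos' (fun σ _ => ?_) ⟨ρ, Finset.mem_univ _, ?_⟩
  · simp only [Matrix.smul_apply, smul_eq_mul, PEquiv.toMatrix_apply]
    split_ifs <;> simp [hw0]
  · simpa [PEquiv.toMatrix_apply, Equiv.toPEquiv_apply] using hρ

/-- With `2 - κ i` loops added at `i`, the digraph of items is 2-regular and half its adjacency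
matrix is doubly stochastic. The second alternative is the use of an added loop. -/
theorem exists_perm_clusters {κ : Fin n → ℕ} (hκ : ∀ i, κ i ≤ 2) {f g : Fin m → Fin n}
    (hf : HasFiberCards κ f) (hg : HasFiberCards κ g) :
    ∃ ρ : Equiv.Perm (Fin n), ∀ i, (∃ j, f j = i ∧ g j = ρ i) ∨ (ρ i = i ∧ κ i ≤ 1) := by
  let M : Matrix (Fin n) (Fin n) ℝ := Matrix.of fun i k =>
    (((Finset.univ.filter fun j => f j = i ∧ g j = k).card : ℝ) +
      if i = k then 2 - (κ i : ℝ) else 0) / 2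
  have hκ' : ∀ i, (κ i : ℝ) ≤ 2 := fun i => by exact_mod_cast hκ i
  have hrow : ∀ i, ∑ k, (Finset.univ.filter fun j => f j = i ∧ g j = k).card = κ i := by
    intro i
    rw [← hf i, Finset.card_eq_sum_card_fiberwise (f := g) (t := Finset.univ) (by simp)]
    simp only [Finset.filter_filter]
  have hcol : ∀ k, ∑ i, (Finset.univ.filter fun j => f j = i ∧ g j = k).card = κ k := by
    intro k
    rw [← hg k, Finset.card_eq_sum_card_fiberwise (f := f) (t := Finset.univ) (by simp)]
    simp only [Finset.filter_filter, and_comm]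
  have hM : M ∈ doublyStochastic ℝ (Fin n) := by
    rw [mem_doublyStochastic_iff_sum]
    refine ⟨fun i k => ?_, fun i => ?_, fun k => ?_⟩
    · have := hκ' i
      simp only [M, Matrix.of_apply]
      refine div_nonneg (add_nonneg (Nat.cast_nonneg _) ?_) (by norm_num)
      split_ifs
      · linarith
      · exact le_rfl
    · simp only [M, Matrix.of_apply]
      rw [← Finset.sum_div, Finset.sum_add_distrib, ← Nat.cast_sum, hrow, Finset.sum_ite_eq,
        if_pos (Finset.mem_univ _)]
      ring
    · simp only [M, Matrix.of_apply]
      rw [← Finset.sum_div, Finset.sum_add_distrib, ← Nat.cast_sum, hcol, Finset.sum_ite_eq',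
        if_pos (Finset.mem_univ _)]
      ring
  obtain ⟨ρ, hρ⟩ := exists_perm_pos_of_mem_doublyStochastic hM
  refine ⟨ρ, fun i => ?_⟩
  by_contra! hcon
  have h0 : (Finset.univ.filter fun j => f j = i ∧ g j = ρ i).card = 0 := by
    rw [Finset.card_eq_zero, Finset.filter_eq_empty_iff]
    exact fun j _ h => hcon.1 j h.1 h.2
  have h1 := hρ i
  simp only [M, Matrix.of_apply, h0] at h1
  split_ifs at h1 with h2
  · have h3 := hcon.2 h2.symm
    norm_num at h1
    lia
  · norm_num at h1

/-- If no cluster has more than two items, any two assignments differ by a product of two balanced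
permutations with disjoint supports. -/
theorem exists_isPBalanced_mul {κ : Fin n → ℕ} (hκ : ∀ i, κ i ≤ 2) {f g : Fin m → Fin n}
    (hf : HasFiberCards κ f) (hg : HasFiberCards κ g) :
    ∃ π₁ π₂ : Equiv.Perm (Fin m), IsPBalanced f π₁ ∧ IsPBalanced f π₂ ∧
      Disjoint π₁.support π₂.support ∧ f ∘ (π₂ * π₁) = g := by
  classical
  obtain ⟨ρ, hρ⟩ := exists_perm_clusters hκ hf hg
  -- Clusters whose edge in the one-factor comes from an actual item; `J` collects one such item for
  -- each.
  let I : Finset (Fin n) := Finset.univ.filter fun i => ∃ j, f j = i ∧ g j = ρ i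
  have hI : ∀ i, i ∈ I ↔ ∃ j, f j = i ∧ g j = ρ i := by simp [I]
  have hInot : ∀ i, i ∉ I → ρ i = i ∧ κ i ≤ 1 := fun i hi =>
    (hρ i).resolve_left (mt (hI i).2 hi)
  choose s hsf hsg using fun i : I => (hI i).1 i.2
  let J : Finset (Fin m) := Finset.univ.image s
  have hJ : ∀ j, j ∈ J ↔ ∃ i, s i = j := by simp [J]
  have hfJ : ∀ k, (J.filter (f · = k)).card = if k ∈ I then 1 else 0 := by
    intro k
    split_ifs with hk
    · refine Finset.card_eq_one.2 ⟨s ⟨k, hk⟩, ?_⟩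
      ext j
      simp only [Finset.mem_filter, hJ, Finset.mem_singleton]
      constructor
      · rintro ⟨⟨i, rfl⟩, h⟩
        exact congrArg s (Subtype.ext ((hsf i).symm.trans h))
      · rintro rfl
        exact ⟨⟨_, rfl⟩, hsf _⟩
    · refine Finset.card_eq_zero.2 (Finset.filter_eq_empty_iff.2 fun j hj h => hk ?_)
      obtain ⟨i, rfl⟩ := (hJ j).1 hj
      rw [← h, hsf]
      exact i.2
  have hρI : ∀ i, ρ i ∈ I ↔ i ∈ I := by
    intro i
    by_cases hi : i ∈ I
    · refine iff_of_true ?_ hi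
      by_contra h
      have := ρ.injective (hInot _ h).1
      exact h (this.symm ▸ hi)
    · rw [(hInot i hi).1]
  have hgJ : ∀ k, (J.filter (g · = k)).card = if k ∈ I then 1 else 0 := by
    intro k
    obtain ⟨l, rfl⟩ := ρ.surjective k
    simp only [hρI]
    split_ifs with hk
    · refine Finset.card_eq_one.2 ⟨s ⟨l, hk⟩, ?_⟩
      ext j
      simp only [Finset.mem_filter, hJ, Finset.mem_singleton]
      constructor
      · rintro ⟨⟨i, rfl⟩, h⟩
        exact congrArg s (Subtype.ext (ρ.injective ((hsg i).symm.trans h)))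
      · rintro rfl
        exact ⟨⟨_, rfl⟩, hsg _⟩
    · refine Finset.card_eq_zero.2 (Finset.filter_eq_empty_iff.2 fun j hj h => hk ?_)
      obtain ⟨i, rfl⟩ := (hJ j).1 hj
      rw [hsg] at h
      exact ρ.injective h ▸ i.2
  have hcompl : ∀ (k : Fin m → Fin n) y, (Finset.univ.filter (k · = y)).card =
      (J.filter (k · = y)).card + (Jᶜ.filter (k · = y)).card := by
    intro k y
    rw [← Finset.card_union_of_disjoint (Finset.disjoint_filter_filter disjoint_compl_right),
      ← Finset.filter_union, Finset.union_compl]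
  have hf' : ∀ k, (if k ∈ I then 1 else 0) + (Jᶜ.filter (f · = k)).card = κ k := fun k => by
    rw [← hf k, hcompl, hfJ]
  have hg' : ∀ k, (if k ∈ I then 1 else 0) + (Jᶜ.filter (g · = k)).card = κ k := fun k => by
    rw [← hg k, hcompl, hgJ]
  obtain ⟨π₁, hπ₁, hfπ₁⟩ := exists_perm_comp_eq_on J f g fun k => by rw [hfJ, hgJ]
  obtain ⟨π₂, hπ₂, hfπ₂⟩ := exists_perm_comp_eq_on Jᶜ f g fun k => by
    have h1 := hf' k
    have h2 := hg' k
    lia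
  have hinj : ∀ {T : Finset (Fin m)}, (∀ k, (T.filter (f · = k)).card ≤ 1) → Set.InjOn f T := by
    intro T hT x hx y hy hxy
    exact Finset.card_le_one.1 (hT (f y)) x (Finset.mem_filter.2 ⟨hx, hxy⟩) y
      (Finset.mem_filter.2 ⟨hy, rfl⟩)
  have hdis : Disjoint π₁.support π₂.support := disjoint_compl_right.mono hπ₁ hπ₂
  refine ⟨π₁, π₂, (hinj fun k => ?_).mono (Finset.coe_subset.2 hπ₁),
    (hinj fun k => ?_).mono (Finset.coe_subset.2 hπ₂), hdis, ?_⟩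
  · rw [hfJ]; split_ifs <;> simp
  · have h1 := hf' k
    have h2 := hκ k
    -- On `I`, one of at most two items is already in `J`; off `I`, the cluster has at most one
    -- item.
    by_cases hk : k ∈ I
    · rw [if_pos hk] at h1; lia
    · have h3 := (hInot k hk).2; lia
  · funext j
    simp only [Function.comp, Equiv.Perm.mul_apply]
    by_cases hj : j ∈ J
    · have hj' : π₁ j ∉ π₂.support := by
        intro h
        have hJ' : π₁ j ∉ J := Finset.mem_compl.1 (hπ₂ h)
        by_cases hs : j ∈ π₁.support
        · exact hJ' (hπ₁ (Equiv.Perm.apply_mem_support.2 hs))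
        · rw [Equiv.Perm.notMem_support.1 hs] at hJ'
          exact hJ' hj
      rw [Equiv.Perm.notMem_support.1 hj', hfπ₁ j hj]
    · rw [Equiv.Perm.notMem_support.1 (mt (@hπ₁ j) hj), hfπ₂ j (Finset.mem_compl.2 hj)]

/-- Later steps start from `p ∘ τ` rather than `p`; conjugating by `τ` transports the exchange
there. -/
theorem IsPCycle.conj {p : Fin m → Fin n} {σ : Equiv.Perm (Fin m)} (h : IsPCycle p σ)
    (τ : Equiv.Perm (Fin m)) : IsPCycle (p ∘ τ) (τ⁻¹ * σ * τ) := by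
  constructor
  · rcases h.1 with rfl | hc
    · exact Or.inl (by group)
    · exact Or.inr (by simpa using hc.conj (g := τ⁻¹))
  · have hs : ∀ x ∈ (τ⁻¹ * σ * τ).support, τ x ∈ σ.support := by
      intro x hx
      rw [Equiv.Perm.mem_support] at hx ⊢
      intro h
      exact hx (by simp [h])
    exact fun x hx y hy hxy => τ.injective (h.2 (hs x hx) (hs y hy) hxy)

theorem edist_assignmentVertex_le_three {κ : Fin n → ℕ} (hκ : ∀ i, κ i ≤ 2) {f g : Fin m → Fin n}
    (hf : HasFiberCards κ f) (hg : HasFiberCards κ g) :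
    (polytopeGraph (partitionPolytope m κ)).edist (assignmentVertex f hf)
      (assignmentVertex g hg) ≤ 3 := by
  obtain ⟨π₁, π₂, h₁, h₂, hd, rfl⟩ := exists_isPBalanced_mul hκ hf hg
  obtain ⟨σ₁, σ₂, σ₃, hσ₁, hσ₂, hσ₃, -, he⟩ := exists_three_isPCycle h₁ h₂ hd
  have step : ∀ {a b : Fin m → Fin n} (ha : HasFiberCards κ a) (hb : HasFiberCards κ b)
      (σ : Equiv.Perm (Fin m)), IsPCycle a σ → a ∘ σ = b →
      (polytopeGraph (partitionPolytope m κ)).edist (assignmentVertex a ha)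
        (assignmentVertex b hb) ≤ 1 := by
    rintro a _ ha hb σ hσ rfl
    exact edist_assignmentVertex_comp_le_one ha hσ
  have s1 := step hf (hf.comp_perm σ₁) σ₁ hσ₁ rfl
  have s2 := step (hf.comp_perm σ₁) (hf.comp_perm (σ₂ * σ₁)) _ (hσ₂.conj σ₁) (by ext; simp)
  have s3 := step (hf.comp_perm (σ₂ * σ₁)) hg _ (hσ₃.conj (σ₂ * σ₁)) (by rw [← he]; ext; simp)
  refine SimpleGraph.edist_triangle.trans
    ((add_le_add (SimpleGraph.edist_triangle.trans (add_le_add s1 s2)) s3).trans ?_)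
  norm_num

theorem ediam_partitionPolytope_le_three {κ : Fin n → ℕ} (hκ : ∀ i, κ i ≤ 2)
    (hm : ∑ i, κ i = m) : (polytopeGraph (partitionPolytope m κ)).ediam ≤ 3 := by
  rw [SimpleGraph.ediam_le_iff]
  rintro ⟨u, hu⟩ ⟨v, hv⟩
  obtain ⟨f, hf, rfl⟩ := exists_eq_assignmentMatrix hm hu
  obtain ⟨g, hg, rfl⟩ := exists_eq_assignmentMatrix hm hv
  exact edist_assignmentVertex_le_three hκ hf hg

/-! ### The lower bound for `PP(2,2,2,2)` -/

/-- For clusters of at most two items, the two ends of an edge of the partition polytope differ by a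
nontrivial cyclic exchange. -/
theorem exists_isCycle_of_adj {κ : Fin n → ℕ} (hκ : ∀ i, κ i ≤ 2) {f g : Fin m → Fin n}
    (hf : HasFiberCards κ f) (hg : HasFiberCards κ g)
    (hadj : (polytopeGraph (partitionPolytope m κ)).Adj (assignmentVertex f hf)
      (assignmentVertex g hg)) :
    ∃ σ : Equiv.Perm (Fin m), σ.IsCycle ∧ IsPBalanced f σ ∧ f ∘ σ = g := by
  have hne : f ≠ g := by
    rintro rfl
    exact hadj.ne rfl
  have hcomp : ∀ {π : Equiv.Perm (Fin m)}, IsPBalanced f π → f ∘ π = f → π = 1 := by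
    intro π hπ h
    by_contra h1
    obtain ⟨x, hx⟩ := Finset.nonempty_iff_ne_empty.2 (mt Equiv.Perm.support_eq_empty_iff.1 h1)
    exact hπ.apply_ne hx (congrFun h x)
  obtain ⟨π, hπ, rfl⟩ : ∃ π : Equiv.Perm (Fin m), IsPBalanced f π ∧ f ∘ π = g := by
    obtain ⟨π₁, π₂, h₁, h₂, hd, he⟩ := exists_isPBalanced_mul hκ hf hg
    -- Stopping after `π₁` gives an assignment between the ends, so the edge leaves only one of the
    -- two factors. The same argument below reduces `π` to one of its cycles.
    have hbetween : ∀ j, (f ∘ π₁) j = f j ∨ (f ∘ π₁) j = g j := by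
      intro j
      by_cases hj : j ∈ π₁.support
      · right
        rw [← he, Function.comp, Function.comp, Equiv.Perm.mul_apply, Equiv.Perm.notMem_support.1
          (Finset.disjoint_left.1 hd (Equiv.Perm.apply_mem_support.2 hj))]
      · left
        rw [Function.comp, Equiv.Perm.notMem_support.1 hj]
    rcases eq_or_eq_of_adj hf hg (hf.comp_perm π₁) hadj hbetween with h | h
    · rw [hcomp h₁ h, mul_one] at he
      exact ⟨π₂, h₂, he⟩
    · exact ⟨π₁, h₁, h⟩
  have hπ1 : π ≠ 1 := by
    rintro rfl
    exact hne rfl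
  obtain ⟨x, hx⟩ := Finset.nonempty_iff_ne_empty.2 (mt Equiv.Perm.support_eq_empty_iff.1 hπ1)
  have hc : (π.cycleOf x).IsCycle := Equiv.Perm.isCycle_cycleOf π (Equiv.Perm.mem_support.1 hx)
  have hcbal : IsPBalanced f (π.cycleOf x) :=
    hπ.of_support_subset (Equiv.Perm.support_cycleOf_le π x)
  have hbetween : ∀ j, (f ∘ π.cycleOf x) j = f j ∨ (f ∘ π.cycleOf x) j = (f ∘ π) j := by
    intro j
    simp only [Function.comp, Equiv.Perm.cycleOf_apply]
    split_ifs
    · exact Or.inr rfl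
    · exact Or.inl rfl
  rcases eq_or_eq_of_adj hf hg (hf.comp_perm (π.cycleOf x)) hadj hbetween with h | h
  · exact absurd (hcomp hcbal h) hc.ne_one
  · exact ⟨_, hc, hcbal, h⟩

theorem three_le_edist_doubled_swaps
    (hf : HasFiberCards ![2, 2, 2, 2] (![0, 0, 1, 1, 2, 2, 3, 3] : Fin 8 → Fin 4))
    (hg : HasFiberCards ![2, 2, 2, 2] (![1, 1, 0, 0, 3, 3, 2, 2] : Fin 8 → Fin 4)) :
    3 ≤ (polytopeGraph (partitionPolytope 8 ![2, 2, 2, 2])).edist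
      (assignmentVertex _ hf) (assignmentVertex _ hg) := by
  have hκ : ∀ i, (![2, 2, 2, 2] : Fin 4 → ℕ) i ≤ 2 := by decide
  have hgf : ∀ j, (![1, 1, 0, 0, 3, 3, 2, 2] : Fin 8 → Fin 4) j =
      (![1, 0, 3, 2] : Fin 4 → Fin 4) ((![0, 0, 1, 1, 2, 2, 3, 3] : Fin 8 → Fin 4) j) := by decide
  have hinv : ∀ i, (![1, 0, 3, 2] : Fin 4 → Fin 4) ((![1, 0, 3, 2] : Fin 4 → Fin 4) i) = i := by
    decide
  have hmove : ∀ j, (![1, 1, 0, 0, 3, 3, 2, 2] : Fin 8 → Fin 4) j ≠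
      (![0, 0, 1, 1, 2, 2, 3, 3] : Fin 8 → Fin 4) j := by decide
  generalize (![0, 0, 1, 1, 2, 2, 3, 3] : Fin 8 → Fin 4) = f at *
  generalize (![1, 1, 0, 0, 3, 3, 2, 2] : Fin 8 → Fin 4) = g at *
  generalize (![1, 0, 3, 2] : Fin 4 → Fin 4) = t at *
  have hcard : ∀ {k : Fin 8 → Fin 4} {σ : Equiv.Perm (Fin 8)}, IsPBalanced k σ →
      σ.support.card ≤ 4 := by
    intro k σ h
    simpa using Finset.card_le_card_of_injOn k (t := Finset.univ) (by simp) h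
  by_contra! hlt
  obtain ⟨w, hw⟩ := SimpleGraph.exists_walk_of_edist_ne_top (ne_top_of_lt hlt)
  rw [← hw] at hlt
  have hlen : w.length < 3 := by exact_mod_cast hlt
  clear hw hlt
  generalize hu : assignmentVertex f hf = u at w
  generalize hv : assignmentVertex g hg = v at w
  rcases w with _ | ⟨h1, _ | ⟨h2, _ | ⟨h3, w⟩⟩⟩
  · have := assignmentMatrix_injective (congrArg Subtype.val (hv.trans hu.symm))
    exact hmove 0 (congrFun this 0)
  · subst hu hv
    obtain ⟨σ, -, hbal, rfl⟩ := exists_isCycle_of_adj hκ hf hg h1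
    have hall : σ.support = Finset.univ := Finset.eq_univ_of_forall fun j =>
      Equiv.Perm.mem_support.2 fun e => hmove j (by simp [e])
    have := hcard hbal
    rw [hall] at this
    simp at this
  · rename_i z
    obtain ⟨z, hz⟩ := z
    obtain ⟨h, hh, rfl⟩ := exists_eq_assignmentMatrix (by simp [Fin.sum_univ_four]) hz
    subst hu hv
    obtain ⟨σ, hσ, hbal, hσh⟩ := exists_isCycle_of_adj hκ hf hh h1
    obtain ⟨τ, -, hbal', hτg⟩ := exists_isCycle_of_adj hκ hh hg h2
    have hall : σ.support ∪ τ.support = Finset.univ := Finset.eq_univ_of_forall fun j => by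
      rw [Finset.mem_union]
      by_contra! hj
      have e1 := Equiv.Perm.notMem_support.1 hj.1
      have e2 := Equiv.Perm.notMem_support.1 hj.2
      exact hmove j (by rw [← hτg, Function.comp, e2, ← hσh, Function.comp, e1])
    have c1 := hcard hbal
    have c2 := hcard hbal'
    have c3 := Finset.card_union_add_card_inter σ.support τ.support
    rw [hall, Finset.card_univ, Fintype.card_fin] at c3
    -- Two supports of size at most four cover eight items, so they are disjoint and each has
    -- exactly four.
    have hdis : Disjoint σ.support τ.support :=
      Finset.disjoint_iff_inter_eq_empty.2 (Finset.card_eq_zero.1 (by lia))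
    have hσt : ∀ j ∈ σ.support, f (σ j) = t (f j) := by
      intro j hj
      rw [← hgf, ← hτg, Function.comp,
        Equiv.Perm.notMem_support.1 (Finset.disjoint_left.1 hdis hj), ← hσh]
      rfl
    -- On its support `σ` acts on clusters as the involution `t`, and `f` is injective there; but a
    -- cycle on four items has order four.
    have hsq : σ ^ 2 = 1 := by
      ext j : 1
      rw [pow_two, Equiv.Perm.mul_apply, Equiv.Perm.one_apply]
      by_cases hj : j ∈ σ.support
      · have hj1 := Equiv.Perm.apply_mem_support.2 hj
        refine hbal (Equiv.Perm.apply_mem_support.2 hj1) hj ?_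
        rw [hσt _ hj1, hσt _ hj, hinv]
      · rw [Equiv.Perm.notMem_support.1 hj, Equiv.Perm.notMem_support.1 hj]
    have hdvd := orderOf_dvd_of_pow_eq_one hsq
    rw [hσ.orderOf] at hdvd
    have := Nat.le_of_dvd (by norm_num) hdvd
    lia
  · simp only [SimpleGraph.Walk.length_cons] at hlen
    lia

end

theorem theorem1p2 :
    -- if `κ₁ ≥ ⋯ ≥ κₙ ≥ 0` and `κ₁ = 2`, then the diameter is at most `3`
    (∀ (n m : ℕ) (hn : 0 < n) (κ : Fin n → ℕ), Antitone κ → κ ⟨0, hn⟩ = 2 → ∑ i, κ i = m →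
      (polytopeGraph (partitionPolytope m κ)).ediam ≤ 3) ∧
    -- the bound is attained
    (polytopeGraph (partitionPolytope 8 ![2, 2, 2, 2])).ediam = 3 ∧
    -- two `p`-balanced permutations with disjoint supports are replaced by three `p`-cycles
    (∀ (m n : ℕ) (p : Fin m → Fin n) (π₁ π₂ : Equiv.Perm (Fin m)),
      IsPBalanced p π₁ → IsPBalanced p π₂ → Disjoint π₁.support π₂.support →
      ∃ σ₁ σ₂ σ₃ : Equiv.Perm (Fin m), IsPCycle p σ₁ ∧ IsPCycle p σ₂ ∧ IsPCycle p σ₃ ∧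
        (σ₃ * σ₂ * σ₁).support = (π₂ * π₁).support ∧
        p ∘ (σ₃ * σ₂ * σ₁) = p ∘ (π₂ * π₁)) := by
  refine ⟨fun n m hn κ hκ h0 hm => ?_, le_antisymm ?_ ?_, fun m n p π₁ π₂ h₁ h₂ hd =>
    exists_three_isPCycle h₁ h₂ hd⟩
  · exact ediam_partitionPolytope_le_three (fun i => h0 ▸ hκ (Nat.zero_le i.1)) hm
  · exact ediam_partitionPolytope_le_three (by decide) (by simp [Fin.sum_univ_four])
  · exact (three_le_edist_doubled_swaps (by unfold HasFiberCards; decide)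
      (by unfold HasFiberCards; decide)).trans
      SimpleGraph.edist_le_ediam
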